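/- \textbf{Theorem (Robust Optimal Strategy with Interbank Exposures).} Consider $m$ banks. Bank $i$ holds liquid assets $e_i>0$ and $z_i\ge 0$ units of an illiquid asset with nominal price $P$, has external liabilities $b_i>0$ and interbank liabilities $L_{ij}\ge 0$ to bank $j$, with $L_{ii}=0$. Put $L_i=b_i+\sum_{j}L_{ij}$, $A_{ij}=L_{ij}/L_i$, and write $\mathbf A_i$ for the $i$-th column of $\mathbf A$. Let the inverse demand function $Q:[0,\sum_j z_j]\to\mathbb R_+$ be twice continuously differentiable and satisfy, on its domain, $Q(0)=P$, $Q'(x)<0$, $(xQ(x))'>0$, $Q''(x)\ge 0$ and $(xQ'(x))'<0$. For early liquidation sizes $\mathbf 0\le\mathbf x\le\mathbf z$, let the clearing price $p>0$ and the clearing payments $\boldsymbol\pi\in\mathbb R^m$ be the (unique) solution of $$p=Q\Big(\sum_{j=1}^m\psi_j\Big),\qquad \pi_i=L_i\wedge\big(e_i+x_iQ(\mathbf 1^\top\mathbf x)+(z_i-x_i)p+\mathbf A_i^\top\boldsymbol\pi\big),\quad i=1,\dots,m,$$ where $\psi_i=\psi_i(\mathbf x)=\dfrac{(L_i-e_i-x_iQ(\mathbf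 1^\top\mathbf x)-\mathbf A_i^\top\boldsymbol\pi)^+}{p}\wedge(z_i-x_i)$ is the number of units sold by bank $i$ at clearing. Let $\bar x_i=\psi_i(\mathbf 0)$ be the liquidation size without early liquidation, and assume $\bar x_j>0$ for all $j$. For $\mathbf 0\le\mathbf x\le\bar{\mathbf x}$ let $c_i(\mathbf x)=x_iQ(\mathbf 1^\top\mathbf x)+(\bar x_i-x_i)Q(\mathbf 1^\top(\bar{\mathbf x}-\mathbf x))$ and $\mathbf c=(c_1,\dots,c_m)^\top$, let $\mathbf w(\mathbf c(\mathbf x))$ be the (unique) Eisenberg--Noe clearing vector solving $\mathbf w=\mathbf L\wedge(\mathbf e+\mathbf c(\mathbf x)+\mathbf A^\top\mathbf w)$, and let $\Phi_i(x_i,\mathbf x_{-i})=e_i+c_i(\mathbf x)+\mathbf A_i^\top\mathbf w(\mathbf c(\mathbf x))$. Then for each $i\in\{1,\dots,m\}$ the max--min problem $$\max_{x_i\in[0,\bar x_i]}\ \min_{\mathbf x_{-i}\in[\mathbf 0,\bar{\mathbf x}_{-i}]}\ \Phi_i(x_i,\mathbf x_{-i})$$ (all of whose inner minima are attained) has exactly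 one outer optimal solution, the robust optimal strategy of bank $i$, and it equals $\bar x_i/2$. -/

import Mathlib

open scoped BigOperators

/-- `Q` is an inverse demand function on `[0, Z]` with nominal price `P`. Only the values of `Q` on
`[0, Z]` matter, so all derivatives are taken within that interval (one-sided at its ends). -/
structure IsInverseDemand (Q : ℝ → ℝ) (P Z : ℝ) : Prop where
  nonneg : ∀ x ∈ Set.Icc 0 Z, 0 ≤ Q x
  contDiffOn : ContDiffOn ℝ 2 Q (Set.Icc 0 Z)
  at_zero : Q 0 = P
  deriv_neg : ∀ x ∈ Set.Icc 0 Z, derivWithin Q (Set.Icc 0 Z) x < 0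
  deriv_revenue_pos : ∀ x ∈ Set.Icc 0 Z, 0 < derivWithin (fun u => u * Q u) (Set.Icc 0 Z) x
  second_deriv_nonneg : ∀ x ∈ Set.Icc 0 Z,
    0 ≤ derivWithin (derivWithin Q (Set.Icc 0 Z)) (Set.Icc 0 Z) x
  deriv_mul_deriv_neg : ∀ x ∈ Set.Icc 0 Z,
    derivWithin (fun u => u * derivWithin Q (Set.Icc 0 Z) u) (Set.Icc 0 Z) x < 0

/-- A system of `m` banks with interbank exposures. -/
structure BankSystem (m : ℕ) where
  /-- value of liquid assets -/
  e : Fin m → ℝ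
  /-- units of the illiquid asset -/
  z : Fin m → ℝ
  /-- liabilities to external entities -/
  b : Fin m → ℝ
  /-- `liab i j` is the nominal liability of bank `i` to bank `j` -/
  liab : Fin m → Fin m → ℝ
  /-- nominal price of the illiquid asset -/
  P : ℝ
  /-- inverse demand function -/
  Q : ℝ → ℝ
  e_pos : ∀ i, 0 < e i
  z_nonneg : ∀ i, 0 ≤ z i
  b_pos : ∀ i, 0 < b i
  liab_nonneg : ∀ i j, 0 ≤ liab i j
  liab_self : ∀ i, liab i i = 0
  demand : IsInverseDemand Q P (∑ i, z i)

namespace IsInverseDemand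

variable {Q : ℝ → ℝ} {P Z : ℝ}

theorem strictAntiOn (h : IsInverseDemand Q P Z) : StrictAntiOn Q (Set.Icc 0 Z) := by
  refine strictAntiOn_of_deriv_neg (convex_Icc 0 Z) h.contDiffOn.continuousOn ?_
  intro x hx
  rw [interior_Icc] at hx
  rw [← derivWithin_of_mem_nhds (Icc_mem_nhds hx.1 hx.2)]
  exact h.deriv_neg x ⟨hx.1.le, hx.2.le⟩

theorem strictMonoOn_revenue (h : IsInverseDemand Q P Z) :
    StrictMonoOn (fun u => u * Q u) (Set.Icc 0 Z) := by
  refine strictMonoOn_of_deriv_pos (convex_Icc 0 Z)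
    (continuousOn_id.mul h.contDiffOn.continuousOn) ?_
  intro x hx
  rw [interior_Icc] at hx
  rw [← derivWithin_of_mem_nhds (Icc_mem_nhds hx.1 hx.2)]
  exact h.deriv_revenue_pos x ⟨hx.1.le, hx.2.le⟩

theorem pos (h : IsInverseDemand Q P Z) {x : ℝ} (hx : x ∈ Set.Icc 0 Z) : 0 < Q x := by
  have h0 : (0 : ℝ) ∈ Set.Icc 0 Z := ⟨le_refl _, hx.1.trans hx.2⟩
  rcases hx.1.eq_or_lt with h1 | h1
  · subst h1
    rcases hx.2.eq_or_lt with h2 | h2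
    · have := h.deriv_neg 0 h0
      rw [← h2, Set.Icc_self, derivWithin_zero_of_not_accPt] at this
      · exact absurd this (lt_irrefl _)
      · rw [accPt_principal_iff_nhdsWithin]
        simp
    · exact lt_of_le_of_lt (h.nonneg Z ⟨h2.le, le_refl _⟩)
        (h.strictAntiOn h0 ⟨h2.le, le_refl _⟩ h2)
  · have h3 := h.strictMonoOn_revenue h0 hx h1
    simp only [zero_mul] at h3
    exact (pos_iff_pos_of_mul_pos h3).1 h1

end IsInverseDemand

namespace BankSystem

variable {m : ℕ} (N : BankSystem m)

/-- Total liabilities `L_i = b_i + ∑_j L_{ij}`. -/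
def L (i : Fin m) : ℝ := N.b i + ∑ j, N.liab i j

/-- Relative liability matrix `A_{ij} = L_{ij} / L_i`. -/
noncomputable def A (i j : Fin m) : ℝ := N.liab i j / N.L i

/-- Payment `A_iᵀ π = ∑_j A_{ji} π_j` received by bank `i` when the banks repay `π`. -/
noncomputable def received (π : Fin m → ℝ) (i : Fin m) : ℝ := ∑ j, N.A j i * π j

/-- Units sold by bank `i` at clearing, after an early liquidation `x`, when the price at clearing
is `p` and the banks repay `π`. -/
noncomputable def sale (x : Fin m → ℝ) (p : ℝ) (π : Fin m → ℝ) (i : Fin m) : ℝ :=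
  min (max (N.L i - N.e i - x i * N.Q (∑ k, x k) - N.received π i) 0 / p) (N.z i - x i)

/-- `(p, π)` is a clearing price (necessarily positive, as inverse demand is positive) together
with a vector of clearing payments after an early liquidation `x`. -/
structure IsClearing (x : Fin m → ℝ) (p : ℝ) (π : Fin m → ℝ) : Prop where
  price_pos : 0 < p
  price_eq : p = N.Q (∑ j, N.sale x p π j)
  payment_eq : ∀ i, π i =
    min (N.L i) (N.e i + x i * N.Q (∑ k, x k) + (N.z i - x i) * p + N.received π i)

/-- The clearing price and payments after an early liquidation `x`; they exist and are unique for
`0 ≤ x ≤ z` by `existsUnique_isClearing`. -/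
noncomputable def clearing (x : Fin m → ℝ) : ℝ × (Fin m → ℝ) :=
  Classical.epsilon fun q : ℝ × (Fin m → ℝ) => N.IsClearing x q.1 q.2

/-- Liquidation size `ψ_i(x)` of bank `i` at clearing, after an early liquidation `x`. -/
noncomputable def liquidation (x : Fin m → ℝ) (i : Fin m) : ℝ :=
  N.sale x (N.clearing x).1 (N.clearing x).2 i

/-- Liquidation size `x̄_i = ψ_i(0)` at clearing in the absence of early liquidation. -/
noncomputable def xbar (i : Fin m) : ℝ := N.liquidation 0 i

/-- Maximum possible income of bank `i` from fire sales,
`c_i(x) = x_i Q(1ᵀx) + (x̄_i - x_i) Q(1ᵀ(x̄ - x))`. -/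
noncomputable def income (x : Fin m → ℝ) (i : Fin m) : ℝ :=
  x i * N.Q (∑ k, x k) + (N.xbar i - x i) * N.Q (∑ k, (N.xbar k - x k))

/-- `w` solves the Eisenberg-Noe equation `w = L ∧ (e + c + Aᵀ w)`. -/
def IsPaymentVector (c w : Fin m → ℝ) : Prop :=
  ∀ i, w i = min (N.L i) (N.e i + c i + N.received w i)

/-- The Eisenberg-Noe clearing vector for the liquidation incomes `c`; it exists and is unique
for `0 ≤ e + c` by `existsUnique_isPaymentVector`. -/
noncomputable def payment (c : Fin m → ℝ) : Fin m → ℝ :=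
  Classical.epsilon fun w : Fin m → ℝ => N.IsPaymentVector c w

/-- The objective `Φ_i(x) = e_i + c_i(x) + A_iᵀ w(c(x))`. -/
noncomputable def objective (i : Fin m) (x : Fin m → ℝ) : ℝ :=
  N.e i + N.income x i + N.received (N.payment (N.income x)) i

/-- `v` is the inner minimum `min_{x_{-i}} Φ_i(t, x_{-i})` over `0 ≤ x_{-i} ≤ x̄_{-i}`, attained. -/
def IsWorstCaseValue (i : Fin m) (t v : ℝ) : Prop :=
  IsLeast (N.objective i '' {x | (∀ j, j ≠ i → x j ∈ Set.Icc 0 (N.xbar j)) ∧ x i = t}) v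

/-- `t` solves the outer problem of `max_{x_i} min_{x_{-i}} Φ_i(x_i, x_{-i})`, `0 ≤ x ≤ x̄`:
all inner minima are attained and the one at `t` is the largest. -/
def IsRobustOptimal (i : Fin m) (t : ℝ) : Prop :=
  t ∈ Set.Icc 0 (N.xbar i) ∧ ∃ v, N.IsWorstCaseValue i t v ∧
    ∀ s ∈ Set.Icc 0 (N.xbar i), ∃ u, N.IsWorstCaseValue i s u ∧ u ≤ v

/-! ### Well-posedness of the definitions -/

theorem L_pos (i : Fin m) : 0 < N.L i :=
  add_pos_of_pos_of_nonneg (N.b_pos i) (Finset.sum_nonneg fun j _ => N.liab_nonneg i j)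

theorem A_nonneg (i j : Fin m) : 0 ≤ N.A i j :=
  div_nonneg (N.liab_nonneg i j) (N.L_pos i).le

theorem sum_A_lt_one (i : Fin m) : ∑ j, N.A i j < 1 := by
  unfold A
  rw [← Finset.sum_div, div_lt_one (N.L_pos i), L]
  linarith [N.b_pos i]

theorem received_mono {π π' : Fin m → ℝ} (h : π ≤ π') (i : Fin m) :
    N.received π i ≤ N.received π' i :=
  Finset.sum_le_sum fun j _ => mul_le_mul_of_nonneg_left (h j) (N.A_nonneg j i)

theorem received_nonneg {π : Fin m → ℝ} (h : 0 ≤ π) (i : Fin m) : 0 ≤ N.received π i :=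
  Finset.sum_nonneg fun j _ => mul_nonneg (N.A_nonneg j i) (h j)

/-- A nonnegative vector dominated in total by what its payment yields vanishes. -/
theorem eq_zero_of_sum_le {d : Fin m → ℝ} (hd : 0 ≤ d)
    (h : ∑ i, d i ≤ ∑ i, N.received d i) : d = 0 := by
  have h1 : ∑ i, N.received d i = ∑ j, (∑ i, N.A j i) * d j := by
    unfold received
    rw [Finset.sum_comm]
    simp_rw [Finset.sum_mul]
  rw [h1] at h
  have h2 : ∑ j, (1 - ∑ i, N.A j i) * d j ≤ 0 := by
    simp_rw [sub_mul, one_mul, Finset.sum_sub_distrib]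
    linarith
  have h3 : ∀ j ∈ Finset.univ, 0 ≤ (1 - ∑ i, N.A j i) * d j := fun j _ =>
    mul_nonneg (by linarith [N.sum_A_lt_one j]) (hd j)
  have h4 := (Finset.sum_eq_zero_iff_of_nonneg h3).1 (le_antisymm h2 (Finset.sum_nonneg h3))
  funext j
  rcases mul_eq_zero.1 (h4 j (Finset.mem_univ j)) with h5 | h5
  · linarith [N.sum_A_lt_one j]
  · exact h5

theorem isPaymentVector_mono {c c' w w' : Fin m → ℝ} (hc : c ≤ c')
    (hw : N.IsPaymentVector c w) (hw' : N.IsPaymentVector c' w') : w ≤ w' := by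
  have h0 : (fun i => max (w i - w' i) 0) = 0 := by
    refine N.eq_zero_of_sum_le (fun i => le_max_right _ _) (Finset.sum_le_sum fun i _ => ?_)
    have h1 : N.received w i - N.received w' i ≤
        N.received (fun i => max (w i - w' i) 0) i := by
      unfold received
      rw [← Finset.sum_sub_distrib]
      refine Finset.sum_le_sum fun j _ => ?_
      rw [← mul_sub]
      exact mul_le_mul_of_nonneg_left (le_max_left _ _) (N.A_nonneg j i)
    have h2 : 0 ≤ N.received (fun i => max (w i - w' i) 0) i :=
      N.received_nonneg (fun i => le_max_right _ _) i
    refine max_le ?_ h2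
    have h3 := hc i
    rw [hw i, hw' i]
    rcases min_choice (N.L i) (N.e i + c' i + N.received w' i) with h4 | h4
    · rw [h4]
      linarith [min_le_left (N.L i) (N.e i + c i + N.received w i)]
    · rw [h4]
      linarith [min_le_right (N.L i) (N.e i + c i + N.received w i)]
  intro i
  have h1 := congrFun h0 i
  have h2 := le_max_left (w i - w' i) 0
  simp only [Pi.zero_apply] at h1
  linarith

/-- A monotone self-map of a box in `ℝ^ι` has a fixed point. -/
theorem exists_fixed_point {ι : Type*} {a b : ι → ℝ} (hab : a ≤ b) (F : (ι → ℝ) → ι → ℝ)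
    (hmono : ∀ y ∈ Set.Icc a b, ∀ y' ∈ Set.Icc a b, y ≤ y' → F y ≤ F y')
    (hmaps : ∀ y ∈ Set.Icc a b, F y ∈ Set.Icc a b) : ∃ y ∈ Set.Icc a b, F y = y := by
  let S : Set (ι → ℝ) := {y | y ∈ Set.Icc a b ∧ y ≤ F y}
  have haS : a ∈ S := ⟨⟨le_refl _, hab⟩, (hmaps a ⟨le_refl _, hab⟩).1⟩
  let s : ι → ℝ := fun i => sSup ((fun y : ι → ℝ => y i) '' S)
  have hle : ∀ y ∈ S, y ≤ s := fun y hy i =>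
    le_csSup ⟨b i, by rintro _ ⟨y, hy, rfl⟩; exact hy.1.2 i⟩ ⟨y, hy, rfl⟩
  have hlub : ∀ u, (∀ y ∈ S, y ≤ u) → s ≤ u := fun u hu i =>
    csSup_le ⟨_, a, haS, rfl⟩ (by rintro _ ⟨y, hy, rfl⟩; exact hu y hy i)
  have hs : s ∈ Set.Icc a b := ⟨hle a haS, hlub b fun y hy => hy.1.2⟩
  have h1 : s ≤ F s := hlub _ fun y hy => hy.2.trans (hmono y hy.1 s hs (hle y hy))
  have h2 : F s ∈ S := ⟨hmaps s hs, hmono s hs _ (hmaps s hs) h1⟩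
  exact ⟨s, hs, le_antisymm (hle _ h2) h1⟩

theorem existsUnique_isPaymentVector {c : Fin m → ℝ} (hc : ∀ i, 0 ≤ N.e i + c i) :
    ∃! w, N.IsPaymentVector c w := by
  obtain ⟨w, _, hw⟩ := exists_fixed_point (a := 0) (b := N.L) (fun i => (N.L_pos i).le)
    (fun w i => min (N.L i) (N.e i + c i + N.received w i))
    (fun y _ y' _ h i => min_le_min le_rfl (by linarith [N.received_mono h i]))
    (fun y hy => ⟨fun i => le_min (N.L_pos i).le (add_nonneg (hc i) (N.received_nonneg hy.1 i)),
      fun i => min_le_left _ _⟩)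
  have hw1 : N.IsPaymentVector c w := fun i => (congrFun hw i).symm
  exact ⟨w, hw1, fun w' hw' => le_antisymm (N.isPaymentVector_mono le_rfl hw' hw1)
    (N.isPaymentVector_mono le_rfl hw1 hw')⟩

theorem payment_spec {c : Fin m → ℝ} (hc : ∀ i, 0 ≤ N.e i + c i) :
    N.IsPaymentVector c (N.payment c) :=
  Classical.epsilon_spec (N.existsUnique_isPaymentVector hc).exists

theorem sale_nonneg {x : Fin m → ℝ} (hx : x ≤ N.z) {p : ℝ} (hp : 0 < p) (π : Fin m → ℝ)
    (i : Fin m) : 0 ≤ N.sale x p π i :=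
  le_min (div_nonneg (le_max_right _ _) hp.le) (sub_nonneg.2 (hx i))

theorem sum_sale_mem {x : Fin m → ℝ} (hx0 : 0 ≤ x) (hx : x ≤ N.z) {p : ℝ} (hp : 0 < p)
    (π : Fin m → ℝ) : ∑ i, N.sale x p π i ∈ Set.Icc 0 (∑ i, N.z i) :=
  ⟨Finset.sum_nonneg fun i _ => N.sale_nonneg hx hp π i,
    Finset.sum_le_sum fun i _ => (min_le_right _ _).trans (sub_le_self _ (hx0 i))⟩

theorem sum_mem {x : Fin m → ℝ} (hx0 : 0 ≤ x) (hx : x ≤ N.z) :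
    ∑ i, x i ∈ Set.Icc 0 (∑ i, N.z i) :=
  ⟨Finset.sum_nonneg fun i _ => hx0 i, Finset.sum_le_sum fun i _ => hx i⟩

theorem sale_anti {x : Fin m → ℝ} {p p' : ℝ} (hp : 0 < p) (hpp : p ≤ p')
    {π π' : Fin m → ℝ} (h : π ≤ π') (i : Fin m) : N.sale x p' π' i ≤ N.sale x p π i := by
  unfold sale
  refine min_le_min ?_ le_rfl
  refine div_le_div₀ (le_max_right _ _) (max_le_max ?_ le_rfl) hp hpp
  linarith [N.received_mono h i]

theorem exists_isClearing {x : Fin m → ℝ} (hx0 : 0 ≤ x) (hx : x ≤ N.z) :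
    ∃ q : ℝ × (Fin m → ℝ), N.IsClearing x q.1 q.2 := by
  have hZ0 : 0 ≤ ∑ i, N.z i := Finset.sum_nonneg fun i _ => N.z_nonneg i
  have h0 : (0 : ℝ) ∈ Set.Icc 0 (∑ i, N.z i) := ⟨le_rfl, hZ0⟩
  have hZ : (∑ i, N.z i) ∈ Set.Icc 0 (∑ i, N.z i) := ⟨hZ0, le_rfl⟩
  have hanti := N.demand.strictAntiOn.antitoneOn
  have hQZ := N.demand.pos hZ
  have hp1 := N.demand.pos (N.sum_mem hx0 hx)
  let a : Option (Fin m) → ℝ := fun o => o.elim (N.Q (∑ i, N.z i)) 0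
  let b : Option (Fin m) → ℝ := fun o => o.elim (N.Q 0) N.L
  let F : (Option (Fin m) → ℝ) → Option (Fin m) → ℝ := fun y o =>
    o.elim (N.Q (∑ j, N.sale x (y none) (fun i => y (some i)) j)) fun i =>
      min (N.L i) (N.e i + x i * N.Q (∑ k, x k) + (N.z i - x i) * y none +
        N.received (fun i => y (some i)) i)
  have hab : a ≤ b := by
    rintro (_ | i)
    · exact hanti h0 hZ hZ0
    · exact (N.L_pos i).le
  have hposy : ∀ y ∈ Set.Icc a b, 0 < y none := fun y hy => lt_of_lt_of_le hQZ (hy.1 none)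
  obtain ⟨y, hy, hF⟩ := exists_fixed_point hab F
    (by
      rintro y hy y' hy' h (_ | i)
      · exact hanti (N.sum_sale_mem hx0 hx (hposy _ hy') _) (N.sum_sale_mem hx0 hx (hposy _ hy) _)
          (Finset.sum_le_sum fun i _ =>
            N.sale_anti (hposy _ hy) (h none) (fun i => h (some i)) i)
      · refine min_le_min le_rfl ?_
        have h1 : N.received (fun i => y (some i)) i ≤ N.received (fun i => y' (some i)) i :=
          N.received_mono (fun i => h (some i)) i
        have h2 : (N.z i - x i) * y none ≤ (N.z i - x i) * y' none :=
          mul_le_mul_of_nonneg_left (h none) (sub_nonneg.2 (hx i))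
        linarith)
    (by
      intro y hy
      have hs := N.sum_sale_mem hx0 hx (hposy _ hy) (fun i => y (some i))
      refine ⟨?_, ?_⟩
      · rintro (_ | i)
        · exact hanti hs hZ hs.2
        · refine le_min (N.L_pos i).le ?_
          have h1 : 0 ≤ N.received (fun i => y (some i)) i :=
            N.received_nonneg (fun i => hy.1 (some i)) i
          have h2 : 0 ≤ (N.z i - x i) * y none :=
            mul_nonneg (sub_nonneg.2 (hx i)) (hposy _ hy).le
          have h3 : 0 ≤ x i * N.Q (∑ k, x k) := mul_nonneg (hx0 i) hp1.le
          have h4 := N.e_pos i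
          change (0 : ℝ) ≤ _
          linarith
      · rintro (_ | i)
        · exact hanti h0 hs hs.1
        · exact min_le_left _ _)
  exact ⟨(y none, fun i => y (some i)), hposy _ hy, (congrFun hF none).symm,
    fun i => (congrFun hF (some i)).symm⟩

/-- The payment of a bank is what it can pay without selling, plus the proceeds of its sale. -/
theorem IsClearing.payment_split {N : BankSystem m} {x : Fin m → ℝ} {p : ℝ} {π : Fin m → ℝ}
    (h : N.IsClearing x p π) (hx : x ≤ N.z) (i : Fin m) :
    π i = min (N.L i) (N.e i + x i * N.Q (∑ k, x k) + N.received π i) + N.sale x p π i * p := by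
  have h1 := h.payment_eq i
  have hp := h.price_pos
  have h2 : 0 ≤ (N.z i - x i) * p := mul_nonneg (sub_nonneg.2 (hx i)) hp.le
  have h3 : N.sale x p π i * p =
      min (max (N.L i - N.e i - x i * N.Q (∑ k, x k) - N.received π i) 0)
        ((N.z i - x i) * p) := by
    unfold sale
    rw [min_mul_of_nonneg _ _ hp.le, div_mul_cancel₀ _ hp.ne']
  rw [h3]
  rw [h1]
  generalize N.received π i = r at *
  generalize x i * N.Q (∑ k, x k) = s at *
  generalize (N.z i - x i) * p = u at *
  simp only [min_def, max_def]
  split_ifs <;> linarith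

theorem IsClearing.unique_aux {N : BankSystem m} {x : Fin m → ℝ} (hx0 : 0 ≤ x) (hx : x ≤ N.z)
    {p p' : ℝ} {π π' : Fin m → ℝ} (h : N.IsClearing x p π) (h' : N.IsClearing x p' π')
    (hpp : p ≤ p') : p = p' ∧ π = π' := by
  have hmono : ∀ {p p' : ℝ} {π π' : Fin m → ℝ}, N.IsClearing x p π → N.IsClearing x p' π' →
      p ≤ p' → π ≤ π' := by
    intro p p' π π' h h' hpp
    refine N.isPaymentVector_mono
      (c := fun i => x i * N.Q (∑ k, x k) + (N.z i - x i) * p)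
      (c' := fun i => x i * N.Q (∑ k, x k) + (N.z i - x i) * p') (fun i => ?_) (fun i => ?_)
      (fun i => ?_)
    · have := mul_le_mul_of_nonneg_left hpp (sub_nonneg.2 (hx i))
      simpa using this
    · rw [h.payment_eq i, ← add_assoc]
    · rw [h'.payment_eq i, ← add_assoc]
  have hle := hmono h h' hpp
  have hpe : p = p' := by
    by_contra hne
    have hlt : p < p' := lt_of_le_of_ne hpp hne
    have hs := N.sum_sale_mem hx0 hx h.price_pos π
    have hs' := N.sum_sale_mem hx0 hx h'.price_pos π'
    have hlts : ∑ j, N.sale x p' π' j < ∑ j, N.sale x p π j := by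
      rw [← N.demand.strictAntiOn.lt_iff_gt hs hs', ← h.price_eq, ← h'.price_eq]
      exact hlt
    have hrev := N.demand.strictMonoOn_revenue hs' hs hlts
    simp only [← h.price_eq, ← h'.price_eq] at hrev
    have hkey : ∑ i, (π' i - π i) ≤ ∑ i, N.received (fun j => π' j - π j) i +
        ((∑ j, N.sale x p' π' j) * p' - (∑ j, N.sale x p π j) * p) := by
      rw [Finset.sum_mul, Finset.sum_mul, ← Finset.sum_sub_distrib, ← Finset.sum_add_distrib]
      refine Finset.sum_le_sum fun i _ => ?_
      have h1 := h.payment_split hx i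
      have h2 := h'.payment_split hx i
      have h3 : N.received (fun j => π' j - π j) i = N.received π' i - N.received π i := by
        simp [received, mul_sub, Finset.sum_sub_distrib]
      have h4 := N.received_mono hle i
      have h5 : min (N.L i) (N.e i + x i * N.Q (∑ k, x k) + N.received π' i) -
          min (N.L i) (N.e i + x i * N.Q (∑ k, x k) + N.received π i) ≤
          N.received π' i - N.received π i := by
        simp only [min_def]
        split_ifs <;> linarith
      rw [h3]
      linarith
    have hzero := N.eq_zero_of_sum_le (d := fun i => π' i - π i)
      (fun i => sub_nonneg.2 (hle i)) (by linarith)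
    have hz1 : ∀ i, π' i - π i = 0 := fun i => congrFun hzero i
    simp only [hz1] at hkey
    simp [received] at hkey
    linarith
  subst hpe
  exact ⟨rfl, le_antisymm hle (hmono h' h le_rfl)⟩

theorem existsUnique_isClearing {x : Fin m → ℝ} (hx0 : 0 ≤ x) (hx : x ≤ N.z) :
    ∃! q : ℝ × (Fin m → ℝ), N.IsClearing x q.1 q.2 := by
  obtain ⟨q, hq⟩ := N.exists_isClearing hx0 hx
  refine ⟨q, hq, fun q' hq' => ?_⟩
  rcases le_total q'.1 q.1 with h | h
  · obtain ⟨h1, h2⟩ := IsClearing.unique_aux hx0 hx hq' hq h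
    exact Prod.ext h1 h2
  · obtain ⟨h1, h2⟩ := IsClearing.unique_aux hx0 hx hq hq' h
    exact Prod.ext h1.symm h2.symm

theorem clearing_spec {x : Fin m → ℝ} (hx0 : 0 ≤ x) (hx : x ≤ N.z) :
    N.IsClearing x (N.clearing x).1 (N.clearing x).2 :=
  Classical.epsilon_spec (p := fun q : ℝ × (Fin m → ℝ) => N.IsClearing x q.1 q.2)
    (N.exists_isClearing hx0 hx)

theorem xbar_mem (i : Fin m) : N.xbar i ∈ Set.Icc 0 (N.z i) := by
  have h := N.clearing_spec (x := 0) le_rfl N.z_nonneg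
  refine ⟨N.sale_nonneg N.z_nonneg h.price_pos _ i, ?_⟩
  refine (min_le_right _ _).trans ?_
  simp

/-- On the feasible set the income is nonnegative, so that the payment vector is well defined. -/
theorem income_nonneg {x : Fin m → ℝ} (hx0 : 0 ≤ x) (hx : x ≤ N.xbar) (i : Fin m) :
    0 ≤ N.income x i := by
  have h1 := N.demand.nonneg _ (N.sum_mem hx0 (hx.trans fun i => (N.xbar_mem i).2))
  have h2 := N.demand.nonneg _ (N.sum_mem (x := fun k => N.xbar k - x k)
    (fun i => sub_nonneg.2 (hx i)) (fun i => (sub_le_self _ (hx0 i)).trans (N.xbar_mem i).2))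
  exact add_nonneg (mul_nonneg (hx0 i) h1) (mul_nonneg (sub_nonneg.2 (hx i)) h2)

end BankSystem

/-! Fix a profile `x` with `x i = x̄ i / 2` and some `t ≠ x̄ i / 2`. It suffices to find `y` with `y
i = t` and `Φ_i(y) < Φ_i(x)` (`exists_objective_lt`). Applied to a minimiser `x` for the half
strategy, this puts the worst case of `t` strictly below that of one half.

The reflection `x ↦ x̄ - x` swaps early and late sales, preserves all incomes and fixes the half
strategy, so one may assume `t < x̄ i / 2` and that the total `X` of `x` is at most `S / 2`, where
`S` is the total of `x̄`. Payments are monotone in incomes, so it is enough that no income rises and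
that of bank `i` strictly falls.

If `X < S / 2` (`exists_income_lt_of_sum_lt`), an intermediate value argument yields a smaller total
`Y < X` at which the other banks can choose positions that leave their own incomes unchanged. Total
income depends only on the total sold early and, by strict concavity of revenue
(`revenue_split_lt`), is smaller at `Y`; bank `i` bears the whole loss. If `X = S / 2`
(`income_smul_lt`), every unit is sold at `Q (S / 2)`, and a proportional profile below one half
lowers every income.

Attainment of the minima follows from compactness and Lipschitz dependence of payments on incomes.
-/

namespace IsInverseDemand

/-! ### Concavity of revenue -/

variable {Q : ℝ → ℝ} {P Z : ℝ}

/-- Revenue `u Q(u)` is strictly concave. -/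
theorem strictConcaveOn_revenue (h : IsInverseDemand Q P Z) (hZ : 0 < Z) :
    StrictConcaveOn ℝ (Set.Icc 0 Z) fun u => u * Q u := by
  have hu : UniqueDiffOn ℝ (Set.Icc 0 Z) := uniqueDiffOn_Icc hZ
  have hdc : ContinuousOn (derivWithin Q (Set.Icc 0 Z)) (Set.Icc 0 Z) :=
    h.contDiffOn.continuousOn_derivWithin hu (by norm_num)
  -- The derivative of revenue is `Q u + u Q' u`, a sum of two strictly decreasing functions.
  have hanti : StrictAntiOn (fun u => u * derivWithin Q (Set.Icc 0 Z) u) (Set.Icc 0 Z) := by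
    refine strictAntiOn_of_deriv_neg (convex_Icc 0 Z) (continuousOn_id.mul hdc) fun x hx => ?_
    rw [interior_Icc] at hx
    rw [← derivWithin_of_mem_nhds (Icc_mem_nhds hx.1 hx.2)]
    exact h.deriv_mul_deriv_neg x ⟨hx.1.le, hx.2.le⟩
  refine StrictAntiOn.strictConcaveOn_of_deriv (convex_Icc 0 Z)
    (continuousOn_id.mul h.contDiffOn.continuousOn) ?_
  rw [interior_Icc]
  have hderiv : ∀ x ∈ Set.Ioo 0 Z,
      deriv (fun u => u * Q u) x = Q x + x * derivWithin Q (Set.Icc 0 Z) x := by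
    intro x hx
    have hn := Icc_mem_nhds hx.1 hx.2
    have hd : DifferentiableAt ℝ Q x :=
      ((h.contDiffOn.differentiableOn (by norm_num)) x ⟨hx.1.le, hx.2.le⟩).differentiableAt hn
    rw [derivWithin_of_mem_nhds hn]
    have h1 : HasDerivAt (fun u => u * Q u) (1 * Q x + x * deriv Q x) x :=
      (hasDerivAt_id x).mul hd.hasDerivAt
    rw [h1.deriv, one_mul]
  intro x hx y hy hxy
  have hx' := Set.Ioo_subset_Icc_self hx
  have hy' := Set.Ioo_subset_Icc_self hy
  rw [hderiv x hx, hderiv y hy]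
  exact add_lt_add (h.strictAntiOn hx' hy' hxy) (hanti hx' hy' hxy)

/-- Splitting a sale of `S` units more evenly strictly increases the total revenue. -/
theorem revenue_split_lt (h : IsInverseDemand Q P Z) {S X Y : ℝ} (hS : S ≤ Z) (hY : 0 ≤ Y)
    (hYX : Y < X) (hX : X ≤ S / 2) :
    Y * Q Y + (S - Y) * Q (S - Y) < X * Q X + (S - X) * Q (S - X) := by
  have hd : 0 < S - Y - Y := by linarith
  have hc := (h.strictConcaveOn_revenue (by linarith)).2 (x := Y) ⟨hY, by linarith⟩
    (y := S - Y) ⟨by linarith, by linarith⟩ (by linarith)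
  -- `X` and `S - X` are the convex combinations of `Y` and `S - Y` with these weights in the two
  -- orders; adding the two concavity inequalities cancels the weights.
  have hμ : 0 < (X - Y) / (S - Y - Y) := div_pos (by linarith) hd
  have hν : 0 < (S - Y - X) / (S - Y - Y) := div_pos (by linarith) hd
  have hs : (X - Y) / (S - Y - Y) + (S - Y - X) / (S - Y - Y) = 1 := by
    field_simp
    ring
  have h1 := hc hν hμ (by linarith)
  have h2 := hc hμ hν hs
  have e1 : (S - Y - X) / (S - Y - Y) * Y + (X - Y) / (S - Y - Y) * (S - Y) = X := by
    field_simp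
    ring
  have e2 : (X - Y) / (S - Y - Y) * Y + (S - Y - X) / (S - Y - Y) * (S - Y) = S - X := by
    field_simp
    ring
  simp only [smul_eq_mul, e1, e2] at h1 h2
  generalize (X - Y) / (S - Y - Y) = μ at *
  generalize (S - Y - X) / (S - Y - Y) = ν at *
  obtain rfl : ν = 1 - μ := by linarith
  linarith

end IsInverseDemand

/-! ### Incomes, payments and harmful responses of the other banks -/

namespace BankSystem

variable {m : ℕ} (N : BankSystem m)

theorem sum_xbar_le : ∑ k, N.xbar k ≤ ∑ k, N.z k :=
  Finset.sum_le_sum fun k _ => (N.xbar_mem k).2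

/-- Liquidating `x` early and the rest later gives the same income as the reverse. -/
theorem income_reflect (x : Fin m → ℝ) : N.income (fun k => N.xbar k - x k) = N.income x := by
  funext j
  simp [income, add_comm]

theorem objective_reflect (i : Fin m) (x : Fin m → ℝ) :
    N.objective i (fun k => N.xbar k - x k) = N.objective i x := by
  simp [objective, income_reflect]

theorem income_eq (x : Fin m → ℝ) (j : Fin m) :
    N.income x j = x j * N.Q (∑ k, x k) +
      (N.xbar j - x j) * N.Q (∑ k, N.xbar k - ∑ k, x k) := by
  rw [income, Finset.sum_sub_distrib]

theorem sum_income (x : Fin m → ℝ) :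
    ∑ j, N.income x j = (∑ k, x k) * N.Q (∑ k, x k) +
      (∑ k, N.xbar k - ∑ k, x k) * N.Q (∑ k, N.xbar k - ∑ k, x k) := by
  simp_rw [income_eq, Finset.sum_add_distrib, ← Finset.sum_mul, Finset.sum_sub_distrib]

theorem payment_mono {c c' : Fin m → ℝ} (hc : ∀ i, 0 ≤ N.e i + c i) (h : c ≤ c') :
    N.payment c ≤ N.payment c' :=
  N.isPaymentVector_mono h (N.payment_spec hc)
    (N.payment_spec fun i => (hc i).trans (by linarith [h i]))

/-- The network contributes only weak monotonicity of payments; strictness comes from the bank's own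
income. -/
theorem objective_lt_of_income {i : Fin m} {x y : Fin m → ℝ} (hy0 : 0 ≤ y) (hy : y ≤ N.xbar)
    (h : N.income y ≤ N.income x) (hi : N.income y i < N.income x i) :
    N.objective i y < N.objective i x := by
  have h1 := N.received_mono (N.payment_mono
    (fun j => add_nonneg (N.e_pos j).le (N.income_nonneg hy0 hy j)) h) i
  unfold objective
  linarith

/-- If less than half of all units is liquidated early, bank `i` can liquidate less early, and the
others adapt, so that only the income of bank `i` changes, for the worse. -/
theorem exists_income_lt_of_sum_lt {i : Fin m} {x : Fin m → ℝ} (hx0 : 0 ≤ x) (hx : x ≤ N.xbar)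
    (hsum : ∑ k, x k < (∑ k, N.xbar k) / 2) {t : ℝ} (ht0 : 0 ≤ t) (ht : t < x i) :
    ∃ y : Fin m → ℝ, 0 ≤ y ∧ y ≤ N.xbar ∧ y i = t ∧ N.income y ≤ N.income x ∧
      N.income y i < N.income x i := by
  have hSZ := N.sum_xbar_le
  have hxiX : x i ≤ ∑ k, x k := Finset.single_le_sum (fun k _ => hx0 k) (Finset.mem_univ i)
  have hc : ∀ j, N.income x j = x j * N.Q (∑ k, x k) +
      (N.xbar j - x j) * N.Q (∑ k, N.xbar k - ∑ k, x k) := N.income_eq x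
  have hTx := N.sum_income x
  have hsplit : ∀ f : Fin m → ℝ, ∑ k, f k = f i + ∑ k ∈ Finset.univ.erase i, f k := fun f =>
    (Finset.add_sum_erase _ f (Finset.mem_univ i)).symm
  have hxs := hsplit x
  set S := ∑ k, N.xbar k with hS
  set X := ∑ k, x k with hX
  have hanti := N.demand.strictAntiOn
  have hmem : ∀ Y ∈ Set.Icc t X, Y ∈ Set.Icc 0 (∑ k, N.z k) ∧ S - Y ∈ Set.Icc 0 (∑ k, N.z k) :=
    fun Y hY => ⟨⟨by linarith [hY.1], by linarith [hY.2]⟩, ⟨by linarith [hY.2], by linarith [hY.1]⟩⟩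
  -- This is the denominator of the witness below. It vanishes at `Y = S / 2`, hence the strict
  -- hypothesis on the total.
  have hgap : ∀ Y ∈ Set.Icc t X, 0 < N.Q Y - N.Q (S - Y) := fun Y hY =>
    sub_pos.2 (hanti (hmem Y hY).1 (hmem Y hY).2 (by linarith [hY.2]))
  have htX : t ≤ X := by linarith
  have hXm := hmem X ⟨htX, le_rfl⟩
  -- Since `Q (S - Y) ≤ Q (S - X) < Q X ≤ Q Y`, the old income of `j` lies between `x̄ j * Q (S -
  -- Y)` and `x̄ j * Q Y`; this will keep `y j` in `[0, x̄ j]`.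
  have hlow : ∀ Y ∈ Set.Icc t X, ∀ j, 0 ≤ N.income x j - N.xbar j * N.Q (S - Y) := by
    intro Y hY j
    have h1 : N.Q (S - Y) ≤ N.Q (S - X) :=
      hanti.antitoneOn hXm.2 (hmem Y hY).2 (by linarith [hY.2])
    have h2 := mul_le_mul_of_nonneg_left h1 (N.xbar_mem j).1
    have h3 := mul_nonneg (hx0 j) (hgap X ⟨htX, le_rfl⟩).le
    rw [hc]
    linarith
  have hupp : ∀ Y ∈ Set.Icc t X, ∀ j,
      N.income x j - N.xbar j * N.Q (S - Y) ≤ N.xbar j * (N.Q Y - N.Q (S - Y)) := by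
    intro Y hY j
    have h1 : N.Q X ≤ N.Q Y := hanti.antitoneOn (hmem Y hY).1 hXm.1 hY.2
    have h2 := mul_le_mul_of_nonneg_left h1 (N.xbar_mem j).1
    have h3 := mul_nonneg (sub_nonneg.2 (hx j)) (hgap X ⟨htX, le_rfl⟩).le
    rw [hc]
    linarith
  -- At early total `Y`, bank `j ≠ i` keeps its income exactly when `y j` is its summand divided by
  -- the price gap. A zero of `f` says that these positions together with `t` do add up to `Y`.
  let f : ℝ → ℝ := fun Y => (Y - t) * (N.Q Y - N.Q (S - Y)) -
    ∑ j ∈ Finset.univ.erase i, (N.income x j - N.xbar j * N.Q (S - Y))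
  have hfc : ContinuousOn f (Set.Icc t X) := by
    have hQ := N.demand.contDiffOn.continuousOn
    have h1 : ContinuousOn N.Q (Set.Icc t X) := hQ.mono fun Y hY => (hmem Y hY).1
    have h2 : ContinuousOn (fun Y => N.Q (S - Y)) (Set.Icc t X) :=
      hQ.comp (by fun_prop) fun Y hY => (hmem Y hY).2
    fun_prop
  have hft : f t ≤ 0 := by
    have := Finset.sum_nonneg fun j (_ : j ∈ Finset.univ.erase i) => hlow t ⟨le_rfl, htX⟩ j
    simp only [f, sub_self, zero_mul]
    linarith
  -- At `Y = X` the others' positions are those of `x`, leaving `f X = (x i - t) * (Q X - Q (S -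
  -- X))`.
  have hfX : 0 < f X := by
    have h1 : ∑ j ∈ Finset.univ.erase i, (N.income x j - N.xbar j * N.Q (S - X)) =
        (∑ j ∈ Finset.univ.erase i, x j) * (N.Q X - N.Q (S - X)) := by
      rw [Finset.sum_mul]
      refine Finset.sum_congr rfl fun j _ => ?_
      rw [hc]
      ring
    have h2 := mul_pos (sub_pos.2 ht) (hgap X ⟨htX, le_rfl⟩)
    have h3 : ∑ j ∈ Finset.univ.erase i, x j = X - x i := by linarith
    simp only [f]
    rw [h1, h3]
    linarith
  obtain ⟨Y, hY, hfY⟩ := intermediate_value_Icc htX hfc ⟨hft, hfX.le⟩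
  have hYX : Y < X := lt_of_le_of_ne hY.2 fun h => by
    rw [h] at hfY
    exact hfX.ne' hfY
  have hg := hgap Y hY
  let y : Fin m → ℝ := Function.update
    (fun j => (N.income x j - N.xbar j * N.Q (S - Y)) / (N.Q Y - N.Q (S - Y))) i t
  have hyi : y i = t := Function.update_self ..
  have hyj : ∀ j, j ≠ i →
      y j = (N.income x j - N.xbar j * N.Q (S - Y)) / (N.Q Y - N.Q (S - Y)) :=
    fun j hj => Function.update_of_ne hj ..
  have hysum : ∑ k, y k = Y := by
    rw [hsplit y, hyi, Finset.sum_congr rfl fun j hj => hyj j (Finset.ne_of_mem_erase hj),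
      ← Finset.sum_div]
    have h1 : ∑ j ∈ Finset.univ.erase i, (N.income x j - N.xbar j * N.Q (S - Y)) =
        (Y - t) * (N.Q Y - N.Q (S - Y)) := by
      simp only [f] at hfY
      linarith
    rw [h1, mul_div_cancel_right₀ _ hg.ne']
    ring
  have hcj : ∀ j, j ≠ i → N.income y j = N.income x j := by
    intro j hj
    have h1 : y j * (N.Q Y - N.Q (S - Y)) = N.income x j - N.xbar j * N.Q (S - Y) := by
      rw [hyj j hj, div_mul_cancel₀ _ hg.ne']
    rw [N.income_eq y, hysum]
    linarith
  have hci : N.income y i < N.income x i := by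
    have h1 := N.demand.revenue_split_lt hSZ (ht0.trans hY.1) hYX hsum.le
    have h2 := N.sum_income y
    rw [hysum] at h2
    have h3 := hsplit (N.income y)
    have h4 := hsplit (N.income x)
    rw [Finset.sum_congr rfl fun j hj => hcj j (Finset.ne_of_mem_erase hj)] at h3
    linarith
  refine ⟨y, fun j => ?_, fun j => ?_, hyi, fun j => ?_, hci⟩
  · by_cases hj : j = i
    · rw [hj, hyi]
      exact ht0
    · rw [hyj j hj]
      exact div_nonneg (hlow Y hY j) hg.le
  · by_cases hj : j = i
    · rw [hj, hyi]
      exact ht.le.trans (hx i)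
    · rw [hyj j hj]
      exact (div_le_iff₀ hg).2 (hupp Y hY j)
  · by_cases hj : j = i
    · rw [hj]
      exact hci.le
    · exact (hcj j hj).le

/-- If exactly half of all units is liquidated early, every bank earns less when all banks
liquidate a common fraction below one half. -/
theorem income_smul_lt (hxbar : ∀ j, 0 < N.xbar j) {x : Fin m → ℝ}
    (hsum : ∑ k, x k = (∑ k, N.xbar k) / 2) {r : ℝ} (hr0 : 0 ≤ r) (hr : r < 1 / 2) (j : Fin m) :
    N.income (fun k => r * N.xbar k) j < N.income x j := by
  have hS : 0 < ∑ k, N.xbar k := Finset.sum_pos (fun k _ => hxbar k) ⟨j, Finset.mem_univ j⟩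
  -- Both prices on the right become `Q (S / 2)`, so that income is `x̄ j * Q (S / 2)`. On the left
  -- it is a share `x̄ j / S` of total revenue, so the comparison of totals applies to each bank.
  rw [income_eq, income_eq, hsum, ← Finset.mul_sum]
  have h1 := N.demand.revenue_split_lt N.sum_xbar_le (mul_nonneg hr0 hS.le)
    (show r * ∑ k, N.xbar k < (∑ k, N.xbar k) / 2 by nlinarith) le_rfl
  generalize ∑ k, N.xbar k = S at *
  rw [show S - S / 2 = S / 2 by ring] at h1 ⊢
  have h2 : S * (r * N.Q (r * S) + (1 - r) * N.Q (S - r * S)) < S * N.Q (S / 2) := by linarith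
  have h3 := mul_lt_mul_of_pos_left (lt_of_mul_lt_mul_left h2 hS.le) (hxbar j)
  linarith

/-- Whatever the others do while bank `i` liquidates half early, they can do worse to it when it
liquidates a different amount early. -/
theorem exists_objective_lt (hxbar : ∀ j, 0 < N.xbar j) {i : Fin m} {x : Fin m → ℝ}
    (hx0 : 0 ≤ x) (hx : x ≤ N.xbar) (hxi : x i = N.xbar i / 2) {t : ℝ}
    (ht : t ∈ Set.Icc 0 (N.xbar i)) (hne : t ≠ N.xbar i / 2) :
    ∃ y : Fin m → ℝ, 0 ≤ y ∧ y ≤ N.xbar ∧ y i = t ∧ N.objective i y < N.objective i x := by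
  have hlow : ∀ t, 0 ≤ t → t < N.xbar i / 2 → ∃ y : Fin m → ℝ, 0 ≤ y ∧ y ≤ N.xbar ∧ y i = t ∧
      N.objective i y < N.objective i x := by
    intro t ht0 ht
    have key : ∀ x : Fin m → ℝ, 0 ≤ x → x ≤ N.xbar → x i = N.xbar i / 2 →
        ∑ k, x k ≤ (∑ k, N.xbar k) / 2 → ∃ y : Fin m → ℝ, 0 ≤ y ∧ y ≤ N.xbar ∧ y i = t ∧
          N.objective i y < N.objective i x := by
      intro x hx0 hx hxi hsum
      rcases hsum.lt_or_eq with h | h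
      · obtain ⟨y, hy0, hy, hyi, h1, h2⟩ :=
          N.exists_income_lt_of_sum_lt hx0 hx h ht0 (by rwa [hxi])
        exact ⟨y, hy0, hy, hyi, N.objective_lt_of_income hy0 hy h1 h2⟩
      -- The common fraction `t / x̄ i` puts bank `i` at `t`.
      · have hr0 : 0 ≤ t / N.xbar i := div_nonneg ht0 (hxbar i).le
        have hr : t / N.xbar i < 1 / 2 := by
          rw [div_lt_iff₀ (hxbar i)]
          linarith
        have hy0 : 0 ≤ fun k => t / N.xbar i * N.xbar k := fun k => mul_nonneg hr0 (hxbar k).le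
        have hy : (fun k => t / N.xbar i * N.xbar k) ≤ N.xbar := fun k =>
          mul_le_of_le_one_left (hxbar k).le (by linarith)
        have h1 := N.income_smul_lt hxbar h hr0 hr
        exact ⟨_, hy0, hy, div_mul_cancel₀ _ (hxbar i).ne',
          N.objective_lt_of_income hy0 hy (fun j => (h1 j).le) (h1 i)⟩
    rcases le_total (∑ k, x k) ((∑ k, N.xbar k) / 2) with h | h
    · exact key x hx0 hx hxi h
    · rw [← N.objective_reflect i x]
      refine key _ (fun k => sub_nonneg.2 (hx k)) (fun k => sub_le_self _ (hx0 k)) ?_ ?_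
      · rw [hxi]
        ring
      · rw [Finset.sum_sub_distrib]
        linarith
  rcases hne.lt_or_gt with h | h
  · exact hlow t ht.1 h
  -- Above one half, solve for the reflected amount and reflect the answer back.
  · obtain ⟨y, hy0, hy, hyi, h1⟩ := hlow (N.xbar i - t) (sub_nonneg.2 ht.2) (by linarith)
    refine ⟨fun k => N.xbar k - y k, fun k => sub_nonneg.2 (hy k),
      fun k => sub_le_self _ (hy0 k), ?_, ?_⟩
    · simp [hyi]
    · rwa [objective_reflect]

/-! ### Continuity of the clearing payments and attainment of the inner minima -/

/-- Each bank passes on less than its whole payment to other banks, since it has external debt.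
Summing the fixed point equations over banks therefore leaves every payment difference with a
positive weight. -/
theorem abs_payment_sub_le {c c' : Fin m → ℝ} (hc : ∀ i, 0 ≤ N.e i + c i)
    (hc' : ∀ i, 0 ≤ N.e i + c' i) (j : Fin m) :
    |N.payment c j - N.payment c' j| ≤ (∑ i, |c i - c' i|) / (1 - ∑ i, N.A j i) := by
  have hA : ∀ j, 0 < 1 - ∑ i, N.A j i := fun j => by linarith [N.sum_A_lt_one j]
  have hw := N.payment_spec hc
  have hw' := N.payment_spec hc'
  generalize N.payment c = w at *
  generalize N.payment c' = w' at *
  have h1 : ∀ i, |w i - w' i| ≤ |c i - c' i| + ∑ j, N.A j i * |w j - w' j| := by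
    intro i
    have h2 : |N.received w i - N.received w' i| ≤ ∑ j, N.A j i * |w j - w' j| := by
      unfold received
      rw [← Finset.sum_sub_distrib]
      refine (Finset.abs_sum_le_sum_abs _ _).trans_eq (Finset.sum_congr rfl fun j _ => ?_)
      rw [← mul_sub, abs_mul, abs_of_nonneg (N.A_nonneg j i)]
    rw [hw i, hw' i]
    refine (abs_min_sub_min_le_max _ _ _ _).trans ?_
    rw [sub_self, abs_zero, max_eq_right (abs_nonneg _)]
    rw [show N.e i + c i + N.received w i - (N.e i + c' i + N.received w' i) =
      (c i - c' i) + (N.received w i - N.received w' i) by ring]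
    exact (abs_add_le _ _).trans (by linarith)
  have h2 : ∑ j, (1 - ∑ i, N.A j i) * |w j - w' j| ≤ ∑ i, |c i - c' i| := by
    have h3 := Finset.sum_le_sum fun i (_ : i ∈ Finset.univ) => h1 i
    rw [Finset.sum_add_distrib, Finset.sum_comm] at h3
    simp_rw [sub_mul, one_mul, Finset.sum_sub_distrib, Finset.sum_mul]
    linarith
  rw [le_div_iff₀ (hA j), mul_comm]
  exact (Finset.single_le_sum (f := fun j => (1 - ∑ i, N.A j i) * |w j - w' j|)
    (fun k _ => mul_nonneg (hA k).le (abs_nonneg _)) (Finset.mem_univ j)).trans h2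

theorem continuousOn_payment (j : Fin m) :
    ContinuousOn (fun c => N.payment c j) {c | ∀ i, 0 ≤ N.e i + c i} := by
  intro c hc
  rw [ContinuousWithinAt, tendsto_iff_dist_tendsto_zero]
  have hlim : Filter.Tendsto (fun c' : Fin m → ℝ => (∑ i, |c' i - c i|) / (1 - ∑ i, N.A j i))
      (nhdsWithin c {c | ∀ i, 0 ≤ N.e i + c i}) (nhds 0) := by
    have h : Continuous fun c' : Fin m → ℝ => (∑ i, |c' i - c i|) / (1 - ∑ i, N.A j i) := by
      fun_prop
    simpa using (h.tendsto c).mono_left nhdsWithin_le_nhds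
  refine squeeze_zero' (Filter.Eventually.of_forall fun _ => dist_nonneg) ?_ hlim
  filter_upwards [self_mem_nhdsWithin] with c' hc'
  exact N.abs_payment_sub_le hc' hc j

theorem continuousOn_income (j : Fin m) :
    ContinuousOn (fun x => N.income x j) (Set.Icc 0 N.xbar) := by
  have hQ := N.demand.contDiffOn.continuousOn
  have h1 : ContinuousOn (fun x : Fin m → ℝ => N.Q (∑ k, x k)) (Set.Icc 0 N.xbar) :=
    hQ.comp (by fun_prop) fun x hx => N.sum_mem hx.1 (hx.2.trans fun k => (N.xbar_mem k).2)
  have h2 : ContinuousOn (fun x : Fin m → ℝ => N.Q (∑ k, (N.xbar k - x k)))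
      (Set.Icc 0 N.xbar) :=
    hQ.comp (by fun_prop) fun x hx => N.sum_mem (x := fun k => N.xbar k - x k)
      (fun k => sub_nonneg.2 (hx.2 k)) fun k => (sub_le_self _ (hx.1 k)).trans (N.xbar_mem k).2
  unfold income
  fun_prop

theorem continuousOn_objective (i : Fin m) :
    ContinuousOn (N.objective i) (Set.Icc 0 N.xbar) := by
  have h1 : ContinuousOn N.income (Set.Icc 0 N.xbar) :=
    continuousOn_pi.2 N.continuousOn_income
  have h2 : ∀ j, ContinuousOn (fun x => N.payment (N.income x) j) (Set.Icc 0 N.xbar) := fun j =>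
    (N.continuousOn_payment j).comp h1 fun x hx k =>
      add_nonneg (N.e_pos k).le (N.income_nonneg hx.1 hx.2 k)
  have h3 := N.continuousOn_income i
  unfold objective received
  fun_prop

theorem mem_Icc_iff_of_apply_eq {i : Fin m} {t : ℝ} (ht : t ∈ Set.Icc 0 (N.xbar i))
    {x : Fin m → ℝ} (hx : x i = t) :
    (∀ j, j ≠ i → x j ∈ Set.Icc 0 (N.xbar j)) ↔ x ∈ Set.Icc 0 N.xbar := by
  refine ⟨fun h => ?_, fun h j _ => ⟨h.1 j, h.2 j⟩⟩
  have h1 : ∀ j, x j ∈ Set.Icc 0 (N.xbar j) := fun j => by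
    by_cases hj : j = i
    · subst hj
      rwa [hx]
    · exact h j hj
  exact ⟨fun j => (h1 j).1, fun j => (h1 j).2⟩

theorem exists_isWorstCaseValue (i : Fin m) {t : ℝ} (ht : t ∈ Set.Icc 0 (N.xbar i)) :
    ∃ v, N.IsWorstCaseValue i t v := by
  have hset : {x : Fin m → ℝ | (∀ j, j ≠ i → x j ∈ Set.Icc 0 (N.xbar j)) ∧ x i = t} =
      Set.Icc 0 N.xbar ∩ {x | x i = t} := by
    ext x
    exact and_congr_left fun h => N.mem_Icc_iff_of_apply_eq ht h
  unfold IsWorstCaseValue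
  rw [hset]
  have hK : IsCompact (Set.Icc 0 N.xbar ∩ {x : Fin m → ℝ | x i = t}) :=
    isCompact_Icc.inter_right (isClosed_eq (continuous_apply i) continuous_const)
  refine (hK.image_of_continuousOn
    ((N.continuousOn_objective i).mono Set.inter_subset_left)).exists_isLeast ?_
  refine Set.Nonempty.image _ ⟨Function.update 0 i t, ?_, Function.update_self ..⟩
  refine (N.mem_Icc_iff_of_apply_eq ht (Function.update_self ..)).1 fun j hj => ?_
  rw [Function.update_of_ne hj]
  exact ⟨le_rfl, (N.xbar_mem j).1⟩

/-! ### Comparison of worst cases -/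

/-- The worst case of liquidating half early is strictly better than any other worst case. -/
theorem IsWorstCaseValue.lt_half {N : BankSystem m} (hxbar : ∀ j, 0 < N.xbar j) {i : Fin m}
    {t u v : ℝ} (ht : t ∈ Set.Icc 0 (N.xbar i)) (hne : t ≠ N.xbar i / 2)
    (hu : N.IsWorstCaseValue i t u) (hv : N.IsWorstCaseValue i (N.xbar i / 2) v) : u < v := by
  -- Attainment at one half keeps the inequality strict: `v` is the objective at an actual profile
  -- `x`, which can be beaten.
  obtain ⟨x, ⟨hx, hxi⟩, rfl⟩ := hv.1
  have hhalf : N.xbar i / 2 ∈ Set.Icc 0 (N.xbar i) :=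
    ⟨by linarith [hxbar i], by linarith [hxbar i]⟩
  have hx' := (N.mem_Icc_iff_of_apply_eq hhalf hxi).1 hx
  obtain ⟨y, hy0, hy, hyi, hlt⟩ := N.exists_objective_lt hxbar hx'.1 hx'.2 hxi ht hne
  exact (hu.2 ⟨y, ⟨fun j _ => ⟨hy0 j, hy j⟩, hyi⟩, rfl⟩).trans_lt hlt

end BankSystem

theorem mainTheorem4 {m : ℕ} (N : BankSystem m) (hxbar : ∀ j : Fin m, 0 < N.xbar j)
    (i : Fin m) (t : ℝ) : N.IsRobustOptimal i t ↔ t = N.xbar i / 2 := by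
  have hhalf : N.xbar i / 2 ∈ Set.Icc 0 (N.xbar i) :=
    ⟨by linarith [hxbar i], by linarith [hxbar i]⟩
  constructor
  · rintro ⟨ht, v, hv, hmax⟩
    by_contra hne
    obtain ⟨u, hu, huv⟩ := hmax _ hhalf
    exact (hv.lt_half hxbar ht hne hu).not_ge huv
  · rintro rfl
    obtain ⟨v, hv⟩ := N.exists_isWorstCaseValue i hhalf
    refine ⟨hhalf, v, hv, fun s hs => ?_⟩
    by_cases hne : s = N.xbar i / 2
    · exact ⟨v, hne ▸ hv, le_rfl⟩
    · obtain ⟨u, hu⟩ := N.exists_isWorstCaseValue i hs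
      exact ⟨u, hu, (hu.lt_half hxbar hs hne hv).le⟩
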